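/- Let $q$ be a complex number with $|q|<1$, and write $(a;q)_\infty=\prod_{k\ge 0}(1-aq^k)$ and $(a,b;q)_\infty=(a;q)_\infty(b;q)_\infty$. Then $$\frac{(q^3,q^3;q^6)_\infty}{(q,q^5;q^6)_\infty}=1+q+\cfrac{q^2-q^3}{1+q^3+\cfrac{q^2+q^4}{1+q^5+\cfrac{q^6-q^9}{1+q^7+\cfrac{q^4+q^8}{1+q^9+\cfrac{q^{10}-q^{15}}{1+q^{11}+\cfrac{q^6+q^{12}}{1+q^{13}+\cdots}}}}}},$$ that is, the continued fraction $1+q+\dfrac{a_1}{b_1+}\,\dfrac{a_2}{b_2+}\,\dfrac{a_3}{b_3+}\cdots$ with $$a_{2k-1}=q^{4k-2}-q^{6k-3},\qquad a_{2k}=q^{2k}+q^{4k}\quad(k\ge 1),\qquad b_n=1+q^{2n+1}\quad(n\ge 1),$$ converges to the quotient of infinite products on the left: its approximants are finite for all but finitely many $n$ and tend to that value. -/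

import Mathlib

open Filter Topology

/-- The infinite `q`-shifted factorial `(a; q)_∞ = ∏_{k ≥ 0} (1 - a q ^ k)`. -/
noncomputable def qPochInf (a q : ℂ) : ℂ :=
  ∏' k : ℕ, (1 - a * q ^ k)

/-- For `‖q‖ < 1` the product defining `(a; q)_∞` converges (unconditionally). -/
theorem multipliable_qPochInf (a q : ℂ) (hq : ‖q‖ < 1) :
    Multipliable fun k : ℕ => 1 - a * q ^ k := by
  have h : Summable fun k : ℕ => ‖-(a * q ^ k)‖ := by
    simpa [norm_mul, norm_pow] using
      (summable_geometric_of_lt_one (norm_nonneg q) hq).mul_left ‖a‖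
  simpa [sub_eq_add_neg] using multipliable_one_add_of_summable h

/-- The infinite continued fraction
`b₀ + a 0 / (b 0 + a 1 / (b 1 + a 2 / (b 2 + ⋯)))`. -/
def infContFract (b₀ : ℂ) (a b : ℕ → ℂ) : GenContFract ℂ where
  h := b₀
  s := Stream'.Seq.ofStream fun n => ⟨a n, b n⟩

/-- The continued fraction `g` converges to the finite value `v`, i.e. its approximants
`A_n / B_n`, seen as points of the Riemann sphere, converge to `v`: all but finitely many of them
are finite (`B_n ≠ 0`), and they tend to `v`. -/
def ContFractConvergesTo (g : GenContFract ℂ) (v : ℂ) : Prop :=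
  (∀ᶠ n in atTop, g.dens n ≠ 0) ∧ Tendsto g.convs atTop (𝓝 v)

/-- The partial numerators
`q² - q³, q² + q⁴, q⁶ - q⁹, q⁴ + q⁸, q¹⁰ - q¹⁵, q⁶ + q¹², …` (indexed from `0`). -/
noncomputable def modSixNum (q : ℂ) (n : ℕ) : ℂ :=
  if Even n then q ^ (2 * n + 2) - q ^ (3 * n + 3) else q ^ (n + 1) + q ^ (2 * n + 2)

/-- The partial denominators `1 + q³, 1 + q⁵, 1 + q⁷, …` (indexed from `0`). -/
noncomputable def modSixDen (q : ℂ) (n : ℕ) : ℂ :=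
  1 + q ^ (2 * n + 3)

/-! Write `F n = tailSeries q n (n / 2)`. These series satisfy the recurrence of the continued
fraction, `F n = (1 + q ^ (2n+1)) F (n+1) + a_n F (n+2)` with `a_n = modSixNum q n`
(`tailSeries_recurrence`), and `F n → 1`. Since `∑ ‖a_n‖` and `∑ ‖q‖ ^ (2n+1)` converge, the
numerators and denominators of the approximants are bounded, and a Casoratian-type invariant forces
them to tend to `F 0` and `F 1` respectively (`contFractConvergesTo_of_three_term`). The value is
therefore `F 0 / F 1`, once `F 1 ≠ 0`.

For `δ = 0, 1`, `F δ` is `(-q²; q²)_∞` times `∑ q ^ (n² + 2δn) (-q; q²)_n / (q⁴; q⁴)_n`. In base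
`q²`, `1 / (q⁴; q⁴)_n` is the `β` side of a Bailey pair relative to `q ^ (2δ)` whose `α` side is of
theta type (`bailey_pair_zero`, `bailey_pair_one`). Interchanging sums (`tsum_bailey`) and applying
the limiting `q`-Gauss sum leaves theta series with quadratic exponent `3r²`, which the triple
product with `x = q³` and `z = 1` or `z = q²` turns into products modulo six. All other factors are
common to `F 0` and `F 1` and cancel. -/

/-! ### Finite and infinite `q`-shifted factorials: limits, nonvanishing, bounds. -/

/-- The finite `q`-shifted factorial `(a; q)_n`. -/
noncomputable def qPoch (a q : ℂ) (n : ℕ) : ℂ :=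
  ∏ k ∈ Finset.range n, (1 - a * q ^ k)

@[simp] theorem qPoch_zero (a q : ℂ) : qPoch a q 0 = 1 := by simp [qPoch]

theorem qPoch_succ (a q : ℂ) (n : ℕ) : qPoch a q (n + 1) = qPoch a q n * (1 - a * q ^ n) :=
  Finset.prod_range_succ _ _

theorem tendsto_qPoch (a : ℂ) {q : ℂ} (hq : ‖q‖ < 1) :
    Tendsto (qPoch a q) atTop (𝓝 (qPochInf a q)) :=
  (multipliable_qPochInf a q hq).hasProd.tendsto_prod_nat

theorem one_sub_ne_zero_of_norm_lt {z : ℂ} (hz : ‖z‖ < 1) : 1 - z ≠ 0 := by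
  intro h
  rw [← sub_eq_zero.1 h, norm_one] at hz
  exact lt_irrefl _ hz

theorem norm_mul_pow_lt_one {a q : ℂ} (ha : ‖a‖ < 1) (hq : ‖q‖ < 1) (n : ℕ) :
    ‖a * q ^ n‖ < 1 := by
  rw [norm_mul, norm_pow]
  exact (mul_le_of_le_one_right (norm_nonneg a)
    (pow_le_one₀ (norm_nonneg q) hq.le)).trans_lt ha

theorem qPoch_ne_zero {a q : ℂ} (ha : ‖a‖ < 1) (hq : ‖q‖ < 1) (n : ℕ) : qPoch a q n ≠ 0 :=
  Finset.prod_ne_zero_iff.2 fun k _ => one_sub_ne_zero_of_norm_lt (norm_mul_pow_lt_one ha hq k)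

theorem qPochInf_ne_zero {a q : ℂ} (ha : ‖a‖ < 1) (hq : ‖q‖ < 1) : qPochInf a q ≠ 0 := by
  have h := tprod_one_add_ne_zero_of_summable (f := fun k : ℕ => -(a * q ^ k))
    (fun k => by
      simpa [sub_eq_add_neg] using one_sub_ne_zero_of_norm_lt (norm_mul_pow_lt_one ha hq k))
    (by simpa [norm_mul, norm_pow] using
      (summable_geometric_of_lt_one (norm_nonneg q) hq).mul_left ‖a‖)
  simpa [qPochInf, sub_eq_add_neg] using h

theorem qPoch_mul_qPochInf (a : ℂ) {q : ℂ} (hq : ‖q‖ < 1) (n : ℕ) :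
    qPoch a q n * qPochInf (a * q ^ n) q = qPochInf a q := by
  have h1 := ((tendsto_qPoch (a * q ^ n) hq).const_mul (qPoch a q n))
  have h2 := (tendsto_qPoch a hq).comp (tendsto_add_atTop_nat n)
  refine tendsto_nhds_unique h1 (h2.congr fun m => ?_)
  simp only [Function.comp, qPoch]
  rw [add_comm m n, Finset.prod_range_add]
  congr 1
  exact Finset.prod_congr rfl fun k _ => by ring

theorem exists_norm_le_of_tendsto {u : ℕ → ℂ} {l : ℂ} (h : Tendsto u atTop (𝓝 l)) :
    ∃ C, 0 ≤ C ∧ ∀ n, ‖u n‖ ≤ C := by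
  obtain ⟨C, hC⟩ := (Metric.isBounded_range_of_tendsto u h).exists_norm_le
  exact ⟨C, (norm_nonneg _).trans (hC (u 0) ⟨0, rfl⟩), fun n => hC _ ⟨n, rfl⟩⟩

theorem exists_norm_qPoch_le (a : ℂ) {q : ℂ} (hq : ‖q‖ < 1) :
    ∃ C, 0 ≤ C ∧ ∀ n, ‖qPoch a q n‖ ≤ C :=
  exists_norm_le_of_tendsto (tendsto_qPoch a hq)

theorem exists_norm_inv_qPoch_le {a q : ℂ} (ha : ‖a‖ < 1) (hq : ‖q‖ < 1) :
    ∃ C, 0 ≤ C ∧ ∀ n, ‖(qPoch a q n)⁻¹‖ ≤ C :=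
  exists_norm_le_of_tendsto ((tendsto_qPoch a hq).inv₀ (qPochInf_ne_zero ha hq))

theorem norm_sq_lt_one {q : ℂ} (hq : ‖q‖ < 1) : ‖q ^ 2‖ < 1 := by
  rw [norm_pow]
  exact pow_lt_one₀ (norm_nonneg q) hq two_ne_zero

theorem norm_pow_le_of_le {q : ℂ} (hq : ‖q‖ < 1) {m n : ℕ} (h : m ≤ n) : ‖q ^ n‖ ≤ ‖q‖ ^ m := by
  rw [norm_pow]
  exact pow_le_pow_of_le_one (norm_nonneg q) hq.le h

/-! ### The limiting `q`-Gauss sum. -/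

/-- The summand of the limiting `q`-Gauss sum in base `q ^ 2`. -/
noncomputable def gaussTerm (q : ℂ) (r d m : ℕ) : ℂ :=
  q ^ (m ^ 2 + 2 * m * d) * qPoch (-q) (q ^ 2) (m + r) /
    (qPoch (q ^ 2) (q ^ 2) m * qPoch (q ^ 2) (q ^ 2) (m + r + d))

theorem exists_norm_gaussTerm_le {q : ℂ} (hq : ‖q‖ < 1) :
    ∃ C, 0 ≤ C ∧ ∀ r d m, ‖gaussTerm q r d m‖ ≤ C * ‖q‖ ^ m := by
  have hp := norm_sq_lt_one hq
  obtain ⟨C, hC, h⟩ := exists_norm_qPoch_le (-q) hp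
  obtain ⟨D, hD, h'⟩ := exists_norm_inv_qPoch_le hp hp
  refine ⟨C * (D * D), by positivity, fun r d m => ?_⟩
  rw [gaussTerm, div_eq_mul_inv, mul_inv, norm_mul, norm_mul, norm_mul]
  have h1 : ‖q ^ (m ^ 2 + 2 * m * d)‖ ≤ ‖q‖ ^ m := norm_pow_le_of_le hq (by nlinarith)
  calc _ ≤ ‖q‖ ^ m * C * (D * D) := by gcongr <;> first | apply h | apply h'
    _ = _ := by ring

theorem summable_gaussTerm {q : ℂ} (hq : ‖q‖ < 1) (r d : ℕ) : Summable (gaussTerm q r d) := by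
  obtain ⟨C, -, h⟩ := exists_norm_gaussTerm_le hq
  exact Summable.of_norm_bounded
    ((summable_geometric_of_lt_one (norm_nonneg q) hq).mul_left C) (h r d)

/-- The difference telescopes in `m`. The boundary term carries `q ^ ((M+1)²)`, so it vanishes as `M
→ ∞` and leaves a contiguous relation in `d`. -/
theorem sum_gaussTerm_sub {q : ℂ} (hq : ‖q‖ < 1) (r d M : ℕ) :
    ∑ m ∈ Finset.range (M + 1),
        (gaussTerm q r d m - (1 + q ^ (2 * d + 1)) * gaussTerm q r (d + 1) m) =
      -(q ^ ((M + 1) ^ 2 + 2 * (M + 1) * d) * qPoch (-q) (q ^ 2) (M + r + 1) /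
        (qPoch (q ^ 2) (q ^ 2) M * qPoch (q ^ 2) (q ^ 2) (M + r + d + 1))) := by
  have hp := norm_sq_lt_one hq
  have h0 := qPoch_ne_zero hp hp
  have h1 : ∀ n : ℕ, 1 - q ^ 2 * (q ^ 2) ^ n ≠ 0 := fun n =>
    one_sub_ne_zero_of_norm_lt (norm_mul_pow_lt_one hp hp n)
  induction M with
  | zero =>
    have e1 := h0 (r + d)
    have e2 := h1 (r + d)
    simp only [zero_add, Finset.sum_range_one, gaussTerm, qPoch_zero, ← add_assoc, qPoch_succ]
    field_simp
    ring
  | succ M ih =>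
    have e1 := h0 M
    have e2 := h0 (M + r + d + 1)
    have e3 := h1 M
    have e4 := h1 (M + r + d + 1)
    rw [Finset.sum_range_succ, ih]
    simp only [gaussTerm, show M + 1 + r = M + r + 1 by ring,
      show M + r + 1 + (d + 1) = M + r + d + 1 + 1 by ring,
      show M + r + 1 + d = M + r + d + 1 by ring]
    rw [qPoch_succ _ _ M, qPoch_succ _ _ (M + r + d + 1), qPoch_succ _ _ (M + r + 1)]
    field_simp
    ring

theorem tsum_gaussTerm_succ {q : ℂ} (hq : ‖q‖ < 1) (r d : ℕ) :
    ∑' m, gaussTerm q r d m = (1 + q ^ (2 * d + 1)) * ∑' m, gaussTerm q r (d + 1) m := by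
  have hp := norm_sq_lt_one hq
  have hs := (summable_gaussTerm hq r d).hasSum.sub
    ((summable_gaussTerm hq r (d + 1)).hasSum.mul_left (1 + q ^ (2 * d + 1)))
  have hs' := hs.tendsto_sum_nat.comp (tendsto_add_atTop_nat 1)
  obtain ⟨C, hC, h⟩ := exists_norm_qPoch_le (-q) hp
  obtain ⟨D, hD, h'⟩ := exists_norm_inv_qPoch_le hp hp
  have hlim : Tendsto (fun M : ℕ => ‖q‖ ^ M * C * (D * D)) atTop (𝓝 0) := by
    simpa using ((tendsto_pow_atTop_nhds_zero_of_lt_one (norm_nonneg q) hq).mul_const C).mul_const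
      (D * D)
  have h0 := squeeze_zero_norm (f := fun M : ℕ => ∑ m ∈ Finset.range (M + 1),
    (gaussTerm q r d m - (1 + q ^ (2 * d + 1)) * gaussTerm q r (d + 1) m)) (fun M => by
      rw [sum_gaussTerm_sub hq, norm_neg, div_eq_mul_inv, mul_inv, norm_mul, norm_mul, norm_mul]
      have h1 : ‖q ^ ((M + 1) ^ 2 + 2 * (M + 1) * d)‖ ≤ ‖q‖ ^ M :=
        norm_pow_le_of_le hq (by nlinarith)
      gcongr <;> first | apply h | apply h') hlim
  exact sub_eq_zero.1 (tendsto_nhds_unique hs' h0)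

theorem tendsto_tsum_gaussTerm {q : ℂ} (hq : ‖q‖ < 1) (r : ℕ) :
    Tendsto (fun d => ∑' m, gaussTerm q r d m) atTop
      (𝓝 (qPoch (-q) (q ^ 2) r / qPochInf (q ^ 2) (q ^ 2))) := by
  have hp := norm_sq_lt_one hq
  obtain ⟨C, -, h⟩ := exists_norm_gaussTerm_le hq
  -- Because of the factor `q ^ (2md)`, only the term `m = 0` survives as `d → ∞`; the limit is
  -- written as a series supported there.
  have hz : ∑' m : ℕ, (if m = 0 then qPoch (-q) (q ^ 2) r / qPochInf (q ^ 2) (q ^ 2) else 0) =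
      qPoch (-q) (q ^ 2) r / qPochInf (q ^ 2) (q ^ 2) := by
    rw [tsum_ite_eq]
  rw [← hz]
  refine tendsto_tsum_of_dominated_convergence
    ((summable_geometric_of_lt_one (norm_nonneg q) hq).mul_left C) (fun m => ?_)
    (Eventually.of_forall fun d m => h r d m)
  have hP : Tendsto (fun d => qPoch (q ^ 2) (q ^ 2) (m + r + d)) atTop
      (𝓝 (qPochInf (q ^ 2) (q ^ 2))) := by
    simpa only [Function.comp_def, add_comm] using
      (tendsto_qPoch (q ^ 2) hp).comp (tendsto_add_atTop_nat (m + r))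
  have hne := qPochInf_ne_zero hp hp
  rcases eq_or_ne m 0 with rfl | hm
  · simp only [gaussTerm, zero_add] at hP ⊢
    simpa [Pi.div_def] using tendsto_const_nhds.div hP hne
  · have hpow : Tendsto (fun d : ℕ => q ^ (m ^ 2 + 2 * m * d)) atTop (𝓝 0) := by
      refine squeeze_zero_norm (fun d => ?_)
        (tendsto_pow_atTop_nhds_zero_of_lt_one (norm_nonneg q) hq)
      refine norm_pow_le_of_le hq ?_
      have : 1 ≤ m := Nat.one_le_iff_ne_zero.2 hm
      nlinarith
    have := (hpow.mul_const (qPoch (-q) (q ^ 2) (m + r))).div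
      (hP.const_mul (qPoch (q ^ 2) (q ^ 2) m)) (mul_ne_zero (qPoch_ne_zero hp hp m) hne)
    simpa [gaussTerm, hm, Pi.div_def] using this

theorem tsum_gaussTerm_eq_qPoch_mul {q : ℂ} (hq : ‖q‖ < 1) (r d : ℕ) :
    ∑' m, gaussTerm q r 0 m = qPoch (-q) (q ^ 2) d * ∑' m, gaussTerm q r d m := by
  induction d with
  | zero => simp
  | succ d ih =>
    rw [ih, tsum_gaussTerm_succ hq r d, qPoch_succ]
    ring

/-- The limiting `q`-Gauss summation. -/
theorem qPoch_mul_tsum_gaussTerm {q : ℂ} (hq : ‖q‖ < 1) (r d : ℕ) :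
    qPoch (-q) (q ^ 2) d * ∑' m, gaussTerm q r d m =
      qPoch (-q) (q ^ 2) r * (qPochInf (-q) (q ^ 2) / qPochInf (q ^ 2) (q ^ 2)) := by
  have h := (tendsto_qPoch (-q) (norm_sq_lt_one hq)).mul (tendsto_tsum_gaussTerm hq r)
  simp only [← tsum_gaussTerm_eq_qPoch_mul hq] at h ⊢
  rw [tendsto_nhds_unique tendsto_const_nhds h]
  ring

/-! ### Three-term recurrences and convergence of the continued fraction. -/

/-- Discrete Grönwall estimate: each step enlarges the bound by at most `1 + ε n ≤ exp (ε n)`, and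
`∑ ε n` converges. -/
theorem exists_norm_le_of_three_term {a c B : ℕ → ℂ} (ha : Summable fun n => ‖a n‖)
    (hc : Summable fun n => ‖c n‖)
    (hB : ∀ n, B (n + 2) = (1 + c (n + 2)) * B (n + 1) + a (n + 1) * B n) :
    ∃ M, ∀ n, ‖B n‖ ≤ M := by
  have hs : Summable fun n => ‖c (n + 2)‖ + ‖a (n + 1)‖ :=
    ((summable_nat_add_iff 2).2 hc).add ((summable_nat_add_iff 1).2 ha)
  set ε : ℕ → ℝ := fun n => ‖c (n + 2)‖ + ‖a (n + 1)‖ with hε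
  have hε0 : ∀ n, 0 ≤ ε n := fun n => by positivity
  set D := max ‖B 0‖ ‖B 1‖ with hD
  have hD0 : 0 ≤ D := (norm_nonneg _).trans (le_max_left _ _)
  have key : ∀ n, ‖B n‖ ≤ D * Real.exp (∑ i ∈ Finset.range n, ε i) ∧
      ‖B (n + 1)‖ ≤ D * Real.exp (∑ i ∈ Finset.range n, ε i) := by
    intro n
    induction n with
    | zero => simp [hD]
    | succ n ih =>
      set X := D * Real.exp (∑ i ∈ Finset.range n, ε i) with hX
      have hX0 : 0 ≤ X := by positivity
      have hstep : X * (1 + ε n) ≤ D * Real.exp (∑ i ∈ Finset.range (n + 1), ε i) := by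
        rw [Finset.sum_range_succ, Real.exp_add, ← mul_assoc]
        exact mul_le_mul_of_nonneg_left (by linarith [Real.add_one_le_exp (ε n)]) hX0
      refine ⟨ih.2.trans (le_trans ?_ hstep), le_trans ?_ hstep⟩
      · exact le_mul_of_one_le_right hX0 (by linarith [hε0 n])
      · rw [hB]
        calc _ ≤ ‖(1 + c (n + 2)) * B (n + 1)‖ + ‖a (n + 1) * B n‖ := norm_add_le _ _
          _ = ‖1 + c (n + 2)‖ * ‖B (n + 1)‖ + ‖a (n + 1)‖ * ‖B n‖ := by simp only [norm_mul]
          _ ≤ (1 + ‖c (n + 2)‖) * X + ‖a (n + 1)‖ * X := by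
            gcongr
            · exact (norm_add_le _ _).trans (by simp)
            · exact ih.2
            · exact ih.1
          _ = X * (1 + ε n) := by rw [hε]; ring
  refine ⟨D * Real.exp (∑' i, ε i), fun n => (key n).1.trans ?_⟩
  gcongr
  exact hs.sum_le_tsum _ fun i _ => hε0 i

/-- `F` solves the recurrence read backwards, so `B (n+1) F (n+2) + a (n+1) B n F (n+3)` does not
depend on `n`. Its second term tends to `0` because `B` and `F` are bounded, and `F → 1` then
identifies the limit of `B` with the invariant. -/
theorem tendsto_of_three_term {a c F B : ℕ → ℂ} (ha : Summable fun n => ‖a n‖)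
    (hc : Summable fun n => ‖c n‖)
    (hF : ∀ n, F n = (1 + c n) * F (n + 1) + a n * F (n + 2)) (hF1 : Tendsto F atTop (𝓝 1))
    (hB : ∀ n, B (n + 2) = (1 + c (n + 2)) * B (n + 1) + a (n + 1) * B n) :
    Tendsto B atTop (𝓝 (B 1 * F 2 + a 1 * B 0 * F 3)) := by
  obtain ⟨M, hM⟩ := exists_norm_le_of_three_term ha hc hB
  obtain ⟨C, hC, hFC⟩ := exists_norm_le_of_tendsto hF1
  have hinv : ∀ n, B (n + 1) * F (n + 2) + a (n + 1) * B n * F (n + 3) =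
      B 1 * F 2 + a 1 * B 0 * F 3 := by
    intro n
    induction n with
    | zero => rfl
    | succ n ih =>
      rw [← ih, hF (n + 2), hB n]
      ring
  have hF2 : Tendsto (fun n => F (n + 2)) atTop (𝓝 1) := hF1.comp (tendsto_add_atTop_nat 2)
  have hsmall : Tendsto (fun n => a (n + 1) * B n * F (n + 3)) atTop (𝓝 0) := by
    refine squeeze_zero_norm (a := fun n => ‖a (n + 1)‖ * M * C) (fun n => ?_) ?_
    · rw [norm_mul, norm_mul]
      have := (norm_nonneg _).trans (hM 0)
      gcongr
      · exact hM n
      · exact hFC _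
    · simpa using ((ha.tendsto_atTop_zero.comp (tendsto_add_atTop_nat 1)).mul_const M).mul_const C
  have hprod : Tendsto (fun n => B (n + 1) * F (n + 2)) atTop
      (𝓝 (B 1 * F 2 + a 1 * B 0 * F 3)) := by
    have := (tendsto_const_nhds (x := B 1 * F 2 + a 1 * B 0 * F 3)).sub hsmall
    rw [sub_zero] at this
    exact this.congr fun n => by rw [← hinv n]; ring
  rw [← tendsto_add_atTop_iff_nat 1]
  have hdiv := hprod.div hF2 one_ne_zero
  rw [div_one] at hdiv
  refine hdiv.congr' ?_
  filter_upwards [hF2.eventually_ne one_ne_zero] with n hn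
  exact mul_div_cancel_right₀ _ hn

/-- Pincherle theorem for limit-periodic continued fractions with absolutely summable
perturbation of `1 + 0 / (1 + 0 / (1 + ⋯))`. -/
theorem contFractConvergesTo_of_three_term {a c F : ℕ → ℂ} (ha : Summable fun n => ‖a n‖)
    (hc : Summable fun n => ‖c n‖)
    (hF : ∀ n, F n = (1 + c n) * F (n + 1) + a n * F (n + 2)) (hF1 : Tendsto F atTop (𝓝 1))
    (hne : F 1 ≠ 0) :
    ContFractConvergesTo (infContFract (1 + c 0) a fun n => 1 + c (n + 1)) (F 0 / F 1) := by
  set g := infContFract (1 + c 0) a fun n => 1 + c (n + 1) with hg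
  have hget : ∀ n, g.s.get? n = some ⟨a n, 1 + c (n + 1)⟩ := fun n => rfl
  have hnum := tendsto_of_three_term (B := g.nums) ha hc hF hF1 fun n => by
    rw [GenContFract.nums_recurrence (hget (n + 1)) rfl rfl]
  have hden := tendsto_of_three_term (B := g.dens) ha hc hF hF1 fun n => by
    rw [GenContFract.dens_recurrence (hget (n + 1)) rfl rfl]
  -- The invariant at `n = 0` is `F 0` for the numerators and `F 1` for the denominators, by
  -- unwinding the recurrence for `F`.
  have e1 : g.nums 1 * F 2 + a 1 * g.nums 0 * F 3 = F 0 := by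
    rw [GenContFract.first_num_eq (hget 0), GenContFract.zeroth_num_eq_h, hF 0, hF 1]
    change ((1 + c 1) * (1 + c 0) + a 0) * F 2 + a 1 * (1 + c 0) * F 3 = _
    ring
  have e2 : g.dens 1 * F 2 + a 1 * g.dens 0 * F 3 = F 1 := by
    rw [GenContFract.first_den_eq (hget 0), GenContFract.zeroth_den_eq_one, hF 1]
    ring
  rw [e1] at hnum
  rw [e2] at hden
  exact ⟨hden.eventually_ne hne, hnum.div hden hne⟩

/-! ### The series solving the recurrence. -/

/-- The coefficients of the series whose quotients are expanded in the continued fraction. -/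
noncomputable def tailCoeff (q : ℂ) (n : ℕ) : ℂ :=
  q ^ n ^ 2 * qPoch (-q) (q ^ 2) n / qPoch (q ^ 2) (q ^ 2) n

/-- The infinite product `(-q ^ (2n + 2); q ^ 2)_∞`. -/
noncomputable def tailProd (q : ℂ) (n : ℕ) : ℂ :=
  qPochInf (-q ^ 2 * (q ^ 2) ^ n) (q ^ 2)

/-- The series `∑ q ^ (n²) (-q; q²)_n (-q ^ (2n + 2j + 2); q²)_∞ q ^ (2kn) / (q²; q²)_n`. -/
noncomputable def tailSeries (q : ℂ) (k j : ℕ) : ℂ :=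
  ∑' n, tailCoeff q n * q ^ (2 * k * n) * tailProd q (n + j)

theorem tailCoeff_succ {q : ℂ} (hq : ‖q‖ < 1) (n : ℕ) :
    tailCoeff q (n + 1) * (1 - q ^ (2 * n + 2)) =
      tailCoeff q n * q ^ (2 * n + 1) * (1 + q ^ (2 * n + 1)) := by
  have hp := norm_sq_lt_one hq
  have e1 := qPoch_ne_zero hp hp n
  have e2 : 1 - q ^ 2 * (q ^ 2) ^ n ≠ 0 :=
    one_sub_ne_zero_of_norm_lt (norm_mul_pow_lt_one hp hp n)
  rw [tailCoeff, tailCoeff, qPoch_succ, qPoch_succ]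
  field_simp
  ring

theorem tailProd_eq {q : ℂ} (hq : ‖q‖ < 1) (n : ℕ) :
    tailProd q n = (1 + q ^ (2 * n + 2)) * tailProd q (n + 1) := by
  have hp := norm_sq_lt_one hq
  have h := qPoch_mul_qPochInf (-q ^ 2 * (q ^ 2) ^ n) hp 1
  rw [qPoch_succ, qPoch_zero] at h
  rw [tailProd, tailProd, ← h, pow_succ (q ^ 2) n, mul_assoc (-q ^ 2), pow_one]
  ring_nf

theorem tailProd_zero_eq {q : ℂ} (hq : ‖q‖ < 1) (n : ℕ) :
    tailProd q 0 = qPoch (-q ^ 2) (q ^ 2) n * tailProd q n := by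
  rw [tailProd, tailProd, qPoch_mul_qPochInf _ (norm_sq_lt_one hq), pow_zero, mul_one]

theorem norm_neg_sq_lt_one {q : ℂ} (hq : ‖q‖ < 1) : ‖-q ^ 2‖ < 1 := by
  rw [norm_neg]; exact norm_sq_lt_one hq

theorem tailProd_zero_ne_zero {q : ℂ} (hq : ‖q‖ < 1) : tailProd q 0 ≠ 0 := by
  rw [tailProd, pow_zero, mul_one]
  exact qPochInf_ne_zero (norm_neg_sq_lt_one hq) (norm_sq_lt_one hq)

theorem tendsto_tailProd {q : ℂ} (hq : ‖q‖ < 1) : Tendsto (tailProd q) atTop (𝓝 1) := by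
  have hp := norm_sq_lt_one hq
  have hp' := norm_neg_sq_lt_one hq
  have h := (tendsto_const_nhds (x := tailProd q 0)).div (tendsto_qPoch (-q ^ 2) hp)
    (qPochInf_ne_zero hp' hp)
  have h1 : tailProd q 0 / qPochInf (-q ^ 2) (q ^ 2) = 1 := by
    rw [tailProd, pow_zero, mul_one, div_self (qPochInf_ne_zero hp' hp)]
  rw [h1] at h
  refine h.congr fun n => ?_
  rw [Pi.div_apply, tailProd_zero_eq hq n, mul_div_cancel_left₀ _ (qPoch_ne_zero hp' hp n)]

theorem exists_norm_tailCoeff_le {q : ℂ} (hq : ‖q‖ < 1) :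
    ∃ C, 0 ≤ C ∧ ∀ n, ‖tailCoeff q n‖ ≤ C * ‖q‖ ^ n := by
  have hp := norm_sq_lt_one hq
  obtain ⟨C, hC, h⟩ := exists_norm_qPoch_le (-q) hp
  obtain ⟨D, hD, h'⟩ := exists_norm_inv_qPoch_le hp hp
  refine ⟨C * D, by positivity, fun n => ?_⟩
  rw [tailCoeff, div_eq_mul_inv, norm_mul, norm_mul]
  have h1 : ‖q ^ n ^ 2‖ ≤ ‖q‖ ^ n := norm_pow_le_of_le hq (by nlinarith)
  calc _ ≤ ‖q‖ ^ n * C * D := by gcongr <;> first | apply h | apply h'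
    _ = _ := by ring

theorem exists_norm_tailSeries_term_le {q : ℂ} (hq : ‖q‖ < 1) :
    ∃ C, 0 ≤ C ∧ ∀ l j n, ‖tailCoeff q n * q ^ l * tailProd q (n + j)‖ ≤ C * ‖q‖ ^ n := by
  obtain ⟨C, hC, h⟩ := exists_norm_tailCoeff_le hq
  obtain ⟨D, hD, h'⟩ := exists_norm_le_of_tendsto (tendsto_tailProd hq)
  refine ⟨C * D, by positivity, fun l j n => ?_⟩
  rw [norm_mul, norm_mul]
  have h1 : ‖q ^ l‖ ≤ 1 := by simpa using norm_pow_le_of_le hq (Nat.zero_le l)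
  calc _ ≤ C * ‖q‖ ^ n * 1 * D := by gcongr <;> first | apply h | apply h'
    _ = _ := by ring

theorem summable_tailSeries {q : ℂ} (hq : ‖q‖ < 1) (l : ℕ → ℕ) (j : ℕ) :
    Summable fun n => tailCoeff q n * q ^ l n * tailProd q (n + j) := by
  obtain ⟨C, -, h⟩ := exists_norm_tailSeries_term_le hq
  exact Summable.of_norm_bounded
    ((summable_geometric_of_lt_one (norm_nonneg q) hq).mul_left C) fun n => h _ _ _

/-- Summation by parts for the series `tailSeries`. -/
theorem tsum_tailCoeff_one_sub {q : ℂ} (hq : ‖q‖ < 1) (l j : ℕ) :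
    ∑' n, tailCoeff q n * (1 - q ^ (2 * n)) * q ^ (2 * l * n) * tailProd q (n + j) =
      ∑' n, tailCoeff q n * q ^ (2 * n + 1) * (1 + q ^ (2 * n + 1)) * q ^ (2 * l * (n + 1)) *
        tailProd q (n + 1 + j) := by
  have hs : Summable fun n =>
      tailCoeff q n * (1 - q ^ (2 * n)) * q ^ (2 * l * n) * tailProd q (n + j) := by
    refine ((summable_tailSeries hq (fun n => 2 * l * n) j).sub
      (summable_tailSeries hq (fun n => 2 * n + 2 * l * n) j)).congr fun n => ?_
    rw [pow_add]; ring
  rw [hs.tsum_eq_zero_add]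
  simp only [mul_zero, pow_zero, sub_self, zero_mul, zero_add]
  refine tsum_congr fun n => ?_
  rw [← tailCoeff_succ hq n, mul_add 2 n 1, mul_one]

/-- Subtracting `tailSeries q (2j+1) j` inserts `1 - q ^ (2n)`, which summation by parts absorbs.
Peeling one factor off `tailProd` creates a cross term `q ^ (6j+3)`, cancelled by the negative part
of the partial numerator. -/
theorem tailSeries_even {q : ℂ} (hq : ‖q‖ < 1) (j : ℕ) :
    tailSeries q (2 * j) j = (1 + q ^ (4 * j + 1)) * tailSeries q (2 * j + 1) j +
      (q ^ (4 * j + 2) - q ^ (6 * j + 3)) * tailSeries q (2 * j + 2) (j + 1) := by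
  have h := tsum_tailCoeff_one_sub hq (2 * j) j
  have s := fun k j => (summable_tailSeries hq (fun n => 2 * k * n) j).hasSum
  have h1 := (s (2 * j) j).sub (s (2 * j + 1) j)
  have h2 := (((s (2 * j + 1) j).mul_left (q ^ (4 * j + 1)))).add
    ((s (2 * j + 2) (j + 1)).mul_left (q ^ (4 * j + 2) - q ^ (6 * j + 3)))
  have e : tailSeries q (2 * j) j - tailSeries q (2 * j + 1) j =
      q ^ (4 * j + 1) * tailSeries q (2 * j + 1) j +
      (q ^ (4 * j + 2) - q ^ (6 * j + 3)) * tailSeries q (2 * j + 2) (j + 1) := by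
    refine (h1.tsum_eq.symm.trans ?_).trans h2.tsum_eq
    refine Eq.trans (tsum_congr fun n => ?_) (h.trans (tsum_congr fun n => ?_))
    · ring
    · rw [tailProd_eq hq (n + j), show n + 1 + j = n + j + 1 by ring,
        show n + (j + 1) = n + j + 1 by ring]
      ring
  linear_combination e

/-- Here the combination moved to the left has the factor `(1 - q ^ (2n)) (1 + q ^ (2n+2j+2))`; the
second factor accounts for the shift `j → j + 1` in `tailProd`. -/
theorem tailSeries_odd {q : ℂ} (hq : ‖q‖ < 1) (j : ℕ) :
    tailSeries q (2 * j + 1) j = (1 + q ^ (4 * j + 3)) * tailSeries q (2 * j + 2) (j + 1) +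
      (q ^ (2 * j + 2) + q ^ (4 * j + 4)) * tailSeries q (2 * j + 3) (j + 1) := by
  have h := tsum_tailCoeff_one_sub hq (2 * j + 1) j
  have s := fun k j => (summable_tailSeries hq (fun n => 2 * k * n) j).hasSum
  have h1 := ((s (2 * j + 1) j).sub (s (2 * j + 2) (j + 1))).sub
    ((s (2 * j + 3) (j + 1)).mul_left (q ^ (2 * j + 2)))
  have h2 := (((s (2 * j + 2) (j + 1)).mul_left (q ^ (4 * j + 3)))).add
    ((s (2 * j + 3) (j + 1)).mul_left (q ^ (4 * j + 4)))
  have e : tailSeries q (2 * j + 1) j - tailSeries q (2 * j + 2) (j + 1) -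
      q ^ (2 * j + 2) * tailSeries q (2 * j + 3) (j + 1) =
      q ^ (4 * j + 3) * tailSeries q (2 * j + 2) (j + 1) +
      q ^ (4 * j + 4) * tailSeries q (2 * j + 3) (j + 1) := by
    refine (h1.tsum_eq.symm.trans ?_).trans h2.tsum_eq
    refine Eq.trans (tsum_congr fun n => ?_) (h.trans (tsum_congr fun n => ?_))
    · rw [tailProd_eq hq (n + j), show n + (j + 1) = n + j + 1 by ring]
      ring
    · rw [show n + 1 + j = n + j + 1 by ring, show n + (j + 1) = n + j + 1 by ring]
      ring
  linear_combination e

theorem tailSeries_recurrence {q : ℂ} (hq : ‖q‖ < 1) (n : ℕ) :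
    tailSeries q n (n / 2) = (1 + q ^ (2 * n + 1)) * tailSeries q (n + 1) ((n + 1) / 2) +
      modSixNum q n * tailSeries q (n + 2) ((n + 2) / 2) := by
  obtain ⟨j, rfl | rfl⟩ := Nat.even_or_odd' n
  · rw [modSixNum, if_pos (even_two_mul j), show 2 * j / 2 = j by omega,
      show (2 * j + 1) / 2 = j by omega, show (2 * j + 2) / 2 = j + 1 by omega,
      tailSeries_even hq j]
    ring
  · rw [modSixNum, if_neg (by simp), show (2 * j + 1) / 2 = j by omega,
      show (2 * j + 1 + 1) / 2 = j + 1 by omega, show (2 * j + 1 + 2) / 2 = j + 1 by omega,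
      tailSeries_odd hq j]
    ring

theorem tendsto_tailSeries {q : ℂ} (hq : ‖q‖ < 1) :
    Tendsto (fun n => tailSeries q n (n / 2)) atTop (𝓝 1) := by
  obtain ⟨C, hC, h⟩ := exists_norm_tailSeries_term_le hq
  have hz : ∑' m : ℕ, (if m = 0 then (1 : ℂ) else 0) = 1 := tsum_ite_eq 0 _
  rw [← hz]
  refine tendsto_tsum_of_dominated_convergence
    ((summable_geometric_of_lt_one (norm_nonneg q) hq).mul_left C) (fun m => ?_)
    (Eventually.of_forall fun n m => h _ _ _)
  have hP : Tendsto (fun n : ℕ => tailProd q (m + n / 2)) atTop (𝓝 1) := by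
    refine (tendsto_tailProd hq).comp (tendsto_atTop_mono (fun n => Nat.le_add_left _ _)
      (Nat.tendsto_div_const_atTop two_ne_zero))
  rcases eq_or_ne m 0 with rfl | hm
  · simpa [tailCoeff] using hP
  · have hpow : Tendsto (fun n : ℕ => q ^ (2 * n * m)) atTop (𝓝 0) := by
      refine squeeze_zero_norm (fun n => ?_)
        (tendsto_pow_atTop_nhds_zero_of_lt_one (norm_nonneg q) hq)
      refine norm_pow_le_of_le hq ?_
      have : 1 ≤ m := Nat.one_le_iff_ne_zero.2 hm
      nlinarith
    simpa [hm] using (hpow.const_mul (tailCoeff q m)).mul hP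

theorem norm_modSixNum_le {q : ℂ} (hq : ‖q‖ < 1) (n : ℕ) : ‖modSixNum q n‖ ≤ 2 * ‖q‖ ^ n := by
  rw [modSixNum]
  split_ifs
  · refine (norm_sub_le _ _).trans ?_
    linarith [norm_pow_le_of_le hq (show n ≤ 2 * n + 2 by omega),
      norm_pow_le_of_le hq (show n ≤ 3 * n + 3 by omega)]
  · refine (norm_add_le _ _).trans ?_
    linarith [norm_pow_le_of_le hq (show n ≤ 2 * n + 2 by omega),
      norm_pow_le_of_le hq (show n ≤ n + 1 by omega)]

theorem contFractConvergesTo_tailSeries {q : ℂ} (hq : ‖q‖ < 1) (hne : tailSeries q 1 0 ≠ 0) :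
    ContFractConvergesTo (infContFract (1 + q) (modSixNum q) (modSixDen q))
      (tailSeries q 0 0 / tailSeries q 1 0) := by
  have hgeom := summable_geometric_of_lt_one (norm_nonneg q) hq
  have h := contFractConvergesTo_of_three_term (a := modSixNum q)
    (c := fun n => q ^ (2 * n + 1)) (F := fun n => tailSeries q n (n / 2))
    (Summable.of_nonneg_of_le (fun n => norm_nonneg _) (norm_modSixNum_le hq) (hgeom.mul_left 2))
    (Summable.of_nonneg_of_le (fun n => norm_nonneg _)
      (fun n => norm_pow_le_of_le hq (by omega)) hgeom)
    (tailSeries_recurrence hq) (tendsto_tailSeries hq) hne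
  have hd : modSixDen q = fun n => 1 + q ^ (2 * (n + 1) + 1) := rfl
  simpa [hd] using h

/-! ### Bailey's lemma and two Bailey pairs. -/

/-- The inner sum of a Bailey pair in base `q ^ 2` relative to `q ^ (2 * δ)`, with `r + m = n`. -/
noncomputable def baileyTerm (q : ℂ) (δ : ℕ) (α : ℕ → ℂ) (r m : ℕ) : ℂ :=
  α r / (qPoch (q ^ 2) (q ^ 2) m * qPoch (q ^ 2) (q ^ 2) (m + 2 * r + δ))

/-- Absolute convergence allows the sum over `n = r + m` to be taken over `r` and `m` separately.
The exponent splits as `n² + 2δn = (r² + 2δr) + (m² + 2m(r + δ))`, whence the parameter `d = r + δ`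
of `gaussTerm`. -/
theorem tsum_bailey {q : ℂ} (hq : ‖q‖ < 1) (δ : ℕ) {α : ℕ → ℂ} {M : ℝ} (hα : ∀ r, ‖α r‖ ≤ M) :
    ∑' n, q ^ (n ^ 2 + 2 * δ * n) * qPoch (-q) (q ^ 2) n *
        ∑ x ∈ Finset.HasAntidiagonal.antidiagonal n, baileyTerm q δ α x.1 x.2 =
      ∑' r, α r * q ^ (r ^ 2 + 2 * δ * r) * ∑' m, gaussTerm q r (r + δ) m := by
  have hgeom := summable_geometric_of_lt_one (norm_nonneg q) hq
  obtain ⟨C, hC, h⟩ := exists_norm_gaussTerm_le hq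
  have hM : 0 ≤ M := (norm_nonneg _).trans (hα 0)
  set f : ℕ × ℕ → ℂ := fun x =>
    α x.1 * q ^ (x.1 ^ 2 + 2 * δ * x.1) * gaussTerm q x.1 (x.1 + δ) x.2 with hf
  have hsum : Summable f := by
    refine Summable.of_norm_bounded
      ((hgeom.mul_of_nonneg hgeom (fun n => by positivity) fun n => by positivity).mul_left
        (M * C)) fun x => ?_
    rw [hf, norm_mul, norm_mul]
    have h1 : ‖q ^ (x.1 ^ 2 + 2 * δ * x.1)‖ ≤ ‖q‖ ^ x.1 := norm_pow_le_of_le hq (by nlinarith)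
    calc _ ≤ M * ‖q‖ ^ x.1 * (C * ‖q‖ ^ x.2) := by gcongr <;> first | apply h | apply hα
      _ = _ := by ring
  have h1 : ∑' x, f x = ∑' r, α r * q ^ (r ^ 2 + 2 * δ * r) * ∑' m, gaussTerm q r (r + δ) m := by
    rw [hsum.tsum_prod]
    exact tsum_congr fun r => by simp only [hf, tsum_mul_left]
  have hsum' := Finset.HasAntidiagonal.sigmaAntidiagonalEquivProd.summable_iff.2 hsum
  have h2 := hsum'.tsum_sigma' fun n => (hasSum_fintype _).summable
  simp only [Function.comp_apply] at h2
  rw [← h1, ← Finset.HasAntidiagonal.sigmaAntidiagonalEquivProd.tsum_eq f, h2]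
  refine tsum_congr fun n => ?_
  rw [tsum_fintype, Finset.mul_sum, ← Finset.sum_coe_sort]
  refine Finset.sum_congr rfl fun x _ => ?_
  obtain ⟨⟨r, m⟩, hx⟩ := x
  rw [Finset.HasAntidiagonal.mem_antidiagonal] at hx
  simp only at hx
  subst hx
  simp only [hf, baileyTerm, gaussTerm, Finset.HasAntidiagonal.sigmaAntidiagonalEquivProd_apply]
  rw [add_comm m r, show r + m + (r + δ) = m + 2 * r + δ by ring]
  ring

/-- The sequence `1, -2p, 2p⁴, -2p⁹, …` with `p = q²`. -/
noncomputable def alphaZero (q : ℂ) (r : ℕ) : ℂ :=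
  if r = 0 then 1 else 2 * (-1) ^ r * q ^ (2 * r ^ 2)

/-- The sequence `(-1) ^ r p ^ (r²) (1 - p ^ (2r + 1))` with `p = q²`. -/
noncomputable def alphaOne (q : ℂ) (r : ℕ) : ℂ :=
  (-1) ^ r * q ^ (2 * r ^ 2) * (1 - q ^ (4 * r + 2))

theorem one_sub_pow_ne_zero {q : ℂ} (hq : ‖q‖ < 1) (n : ℕ) : 1 - q ^ (n + 1) ≠ 0 :=
  one_sub_ne_zero_of_norm_lt (by rw [norm_pow]; exact pow_lt_one₀ (norm_nonneg q) hq n.succ_ne_zero)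

theorem qPoch_sq_succ (q : ℂ) (n : ℕ) :
    qPoch (q ^ 2) (q ^ 2) (n + 1) = qPoch (q ^ 2) (q ^ 2) n * (1 - q ^ (2 * n + 2)) := by
  rw [qPoch_succ]; ring

/-- With `n = R + m`, the summand is the `r`-th term of `(1 - q ^ (4n+4)) β_{n+1} - β_n`, and it has
closed partial sums. At `m = 0` every `r ≤ n` is included, and the closed form is minus the one
missing term, `r = n + 1`. -/
theorem baileyTerm_alphaZero_sum {q : ℂ} (hq : ‖q‖ < 1) (R m : ℕ) :
    ∑ r ∈ Finset.range (R + 1), ((1 - q ^ (4 * (R + m) + 4)) *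
        baileyTerm q 0 (alphaZero q) r (R - r + m + 1) -
          baileyTerm q 0 (alphaZero q) r (R - r + m)) =
      2 * (-1) ^ R * q ^ (2 * (R + m) + 2 + 2 * R ^ 2 + 2 * R) /
        (qPoch (q ^ 2) (q ^ 2) m * qPoch (q ^ 2) (q ^ 2) (2 * R + m + 1)) := by
  have h0 := fun n => qPoch_ne_zero (norm_sq_lt_one hq) (norm_sq_lt_one hq) n
  have h1 := one_sub_pow_ne_zero hq
  induction R generalizing m with
  | zero =>
    have e1 := h0 m
    have e2 : 1 - q ^ (2 * m + 2) ≠ 0 := h1 _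
    simp only [zero_add, Finset.sum_range_one, baileyTerm, alphaZero, if_pos, Nat.sub_zero,
      mul_zero, add_zero, qPoch_sq_succ]
    field_simp
    ring
  | succ R ih =>
    have e1 := h0 m
    have e2 := h0 (2 * R + m + 2)
    have e3 : 1 - q ^ (2 * m + 2) ≠ 0 := h1 _
    have e4 : 1 - q ^ (2 * (2 * R + m + 2) + 2) ≠ 0 := h1 _
    -- The value `n = R + m` must stay fixed while `R` grows, so the hypothesis is used at `m + 1`.
    have := ih (m + 1)
    rw [Finset.sum_range_succ]
    rw [Finset.sum_congr rfl fun r hr => by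
      rw [show R + 1 - r + m = R - r + (m + 1) by
        have := Finset.mem_range.1 hr; omega, show R + 1 + m = R + (m + 1) by ring], this]
    simp only [baileyTerm, alphaZero, if_neg R.succ_ne_zero, Nat.sub_self, zero_add,
      show 2 * R + (m + 1) + 1 = 2 * R + m + 2 by ring,
      show m + 2 * (R + 1) + 0 = 2 * R + m + 2 by ring,
      show m + 1 + 2 * (R + 1) + 0 = 2 * R + m + 2 + 1 by ring,
      show 2 * (R + 1) + m + 1 = 2 * R + m + 2 + 1 by ring, qPoch_sq_succ]
    field_simp
    ring

theorem baileyTerm_alphaOne_sum {q : ℂ} (hq : ‖q‖ < 1) (R m : ℕ) :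
    ∑ r ∈ Finset.range (R + 1), ((1 - q ^ (4 * (R + m) + 4)) *
        baileyTerm q 1 (alphaOne q) r (R - r + m + 1) -
          baileyTerm q 1 (alphaOne q) r (R - r + m)) =
      (-1) ^ R * q ^ (2 * (R + m) + 2 + 2 * R ^ 2 + 2 * R) * (1 - q ^ (4 * R + 4)) /
        (qPoch (q ^ 2) (q ^ 2) m * qPoch (q ^ 2) (q ^ 2) (2 * R + m + 2)) := by
  have h0 := fun n => qPoch_ne_zero (norm_sq_lt_one hq) (norm_sq_lt_one hq) n
  have h1 := one_sub_pow_ne_zero hq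
  induction R generalizing m with
  | zero =>
    have e1 := h0 m
    have e2 : 1 - q ^ (2 * m + 2) ≠ 0 := h1 _
    have e3 : 1 - q ^ (2 * (m + 1) + 2) ≠ 0 := h1 _
    simp only [zero_add, Finset.sum_range_one, baileyTerm, alphaOne, Nat.sub_zero,
      mul_zero, add_zero, qPoch_sq_succ]
    field_simp
    ring
  | succ R ih =>
    have e1 := h0 m
    have e2 := h0 (2 * R + m + 3)
    have e3 : 1 - q ^ (2 * m + 2) ≠ 0 := h1 _
    have e4 : 1 - q ^ (2 * (2 * R + m + 3) + 2) ≠ 0 := h1 _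
    have := ih (m + 1)
    rw [Finset.sum_range_succ]
    rw [Finset.sum_congr rfl fun r hr => by
      rw [show R + 1 - r + m = R - r + (m + 1) by
        have := Finset.mem_range.1 hr; omega, show R + 1 + m = R + (m + 1) by ring], this]
    simp only [baileyTerm, alphaOne, Nat.sub_self, zero_add,
      show 2 * R + (m + 1) + 2 = 2 * R + m + 3 by ring,
      show m + 2 * (R + 1) + 1 = 2 * R + m + 3 by ring,
      show m + 1 + 2 * (R + 1) + 1 = 2 * R + m + 3 + 1 by ring,
      show 2 * (R + 1) + m + 2 = 2 * R + m + 3 + 1 by ring, qPoch_sq_succ]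
    field_simp
    ring

/-- The hypothesis `h` amounts to `(1 - q ^ (4n+4)) β_{n+1} = β_n`, with the term `r = n + 1` of
`β_{n+1}` moved to the right. This is the recurrence of `1 / (q⁴; q⁴)_n`. -/
theorem bailey_sum_eq {q : ℂ} (hq : ‖q‖ < 1) {δ : ℕ} {α : ℕ → ℂ}
    (h0 : baileyTerm q δ α 0 0 = 1)
    (h : ∀ n, ∑ r ∈ Finset.range (n + 1), ((1 - q ^ (4 * n + 4)) *
        baileyTerm q δ α r (n - r + 1) - baileyTerm q δ α r (n - r)) =
          -((1 - q ^ (4 * n + 4)) * baileyTerm q δ α (n + 1) 0)) (n : ℕ) :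
    ∑ x ∈ Finset.HasAntidiagonal.antidiagonal n, baileyTerm q δ α x.1 x.2 =
      1 / (qPoch (q ^ 2) (q ^ 2) n * qPoch (-q ^ 2) (q ^ 2) n) := by
  rw [Finset.Nat.sum_antidiagonal_eq_sum_range_succ (baileyTerm q δ α)]
  induction n with
  | zero => simpa using h0
  | succ n ih =>
    have hn := h n
    rw [Finset.sum_sub_distrib, ← Finset.mul_sum, ih] at hn
    rw [Finset.sum_range_succ, Nat.sub_self, Finset.sum_congr rfl fun r hr => by
      rw [show n + 1 - r = n - r + 1 by have := Finset.mem_range.1 hr; omega]]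
    have e1 := qPoch_ne_zero (norm_sq_lt_one hq) (norm_sq_lt_one hq) n
    have e2 := qPoch_ne_zero (norm_neg_sq_lt_one hq) (norm_sq_lt_one hq) n
    have e3 : 1 - q ^ (4 * n + 4) ≠ 0 := one_sub_pow_ne_zero hq _
    have e4 : (1 - q ^ (2 * n + 2)) * (1 + q ^ (2 * n + 2)) = 1 - q ^ (4 * n + 4) := by ring
    have e5 := left_ne_zero_of_mul (e4 ▸ e3)
    have e6 := right_ne_zero_of_mul (e4 ▸ e3)
    have e7 : qPoch (-q ^ 2) (q ^ 2) (n + 1) =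
        qPoch (-q ^ 2) (q ^ 2) n * (1 + q ^ (2 * n + 2)) := by rw [qPoch_succ]; ring
    rw [qPoch_sq_succ, e7]
    apply mul_left_cancel₀ e3
    have e8 : (1 - q ^ (4 * n + 4)) * (1 / (qPoch (q ^ 2) (q ^ 2) n * (1 - q ^ (2 * n + 2)) *
        (qPoch (-q ^ 2) (q ^ 2) n * (1 + q ^ (2 * n + 2))))) =
        1 / (qPoch (q ^ 2) (q ^ 2) n * qPoch (-q ^ 2) (q ^ 2) n) := by
      rw [← e4]; field_simp
    rw [e8, mul_add]
    linear_combination hn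

theorem bailey_pair_zero {q : ℂ} (hq : ‖q‖ < 1) (n : ℕ) :
    ∑ x ∈ Finset.HasAntidiagonal.antidiagonal n, baileyTerm q 0 (alphaZero q) x.1 x.2 =
      1 / (qPoch (q ^ 2) (q ^ 2) n * qPoch (-q ^ 2) (q ^ 2) n) := by
  refine bailey_sum_eq hq (by simp [baileyTerm, alphaZero]) (fun n => ?_) n
  have h := baileyTerm_alphaZero_sum hq n 0
  simp only [add_zero] at h
  have e1 := qPoch_ne_zero (norm_sq_lt_one hq) (norm_sq_lt_one hq) (2 * n + 1)
  have e2 : 1 - q ^ (2 * (2 * n + 1) + 2) ≠ 0 := one_sub_pow_ne_zero hq _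
  rw [h, baileyTerm, alphaZero, if_neg n.succ_ne_zero,
    show 0 + 2 * (n + 1) + 0 = 2 * n + 1 + 1 by ring, qPoch_sq_succ q (2 * n + 1), qPoch_zero,
    show 4 * n + 4 = 2 * (2 * n + 1) + 2 by ring]
  field_simp
  ring

theorem bailey_pair_one {q : ℂ} (hq : ‖q‖ < 1) (n : ℕ) :
    ∑ x ∈ Finset.HasAntidiagonal.antidiagonal n, baileyTerm q 1 (alphaOne q) x.1 x.2 =
      1 / (qPoch (q ^ 2) (q ^ 2) n * qPoch (-q ^ 2) (q ^ 2) n) := by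
  have e0 : 1 - q ^ 2 ≠ 0 := one_sub_pow_ne_zero hq 1
  refine bailey_sum_eq hq (by simp [baileyTerm, alphaOne, qPoch_succ, e0]) (fun n => ?_) n
  have h := baileyTerm_alphaOne_sum hq n 0
  simp only [add_zero] at h
  have e1 := qPoch_ne_zero (norm_sq_lt_one hq) (norm_sq_lt_one hq) (2 * n + 2)
  have e2 : 1 - q ^ (2 * (2 * n + 2) + 2) ≠ 0 := one_sub_pow_ne_zero hq _
  rw [h, baileyTerm, alphaOne,
    show 0 + 2 * (n + 1) + 1 = 2 * n + 2 + 1 by ring, qPoch_sq_succ q (2 * n + 2), qPoch_zero]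
  field_simp
  ring

/-! ### Jacobi's triple product. -/

/-- A finite form of Euler's expansion, equivalent to the `q`-binomial theorem. -/
theorem sum_antidiagonal_euler {x : ℂ} (hx : ‖x‖ < 1) (v : ℂ) (N : ℕ) :
    ∑ y ∈ Finset.HasAntidiagonal.antidiagonal N, (-v) ^ y.1 * x ^ y.1 ^ 2 /
        (qPoch (x ^ 2) (x ^ 2) y.1 * qPoch (x ^ 2) (x ^ 2) y.2) =
      qPoch (v * x) (x ^ 2) N / qPoch (x ^ 2) (x ^ 2) N := by
  have h0 := fun n => qPoch_ne_zero (norm_sq_lt_one hx) (norm_sq_lt_one hx) n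
  have h1 : ∀ n : ℕ, 1 - x ^ (2 * n + 2) ≠ 0 := fun n => one_sub_pow_ne_zero hx _
  induction N with
  | zero => simp
  | succ N ih =>
    set g : ℕ × ℕ → ℂ := fun y => (-v) ^ y.1 * x ^ y.1 ^ 2 /
      (qPoch (x ^ 2) (x ^ 2) y.1 * qPoch (x ^ 2) (x ^ 2) y.2) with hg
    -- For `y.1 + y.2 = N + 1`, `1 - x ^ (2N+2) = (1 - x ^ (2 y.2)) + x ^ (2 y.2) (1 - x ^ (2
    -- y.1))`. Each piece kills one endpoint and reindexes to a sum over the antidiagonal of `N`.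
    have e1 : ∑ y ∈ Finset.HasAntidiagonal.antidiagonal (N + 1), (1 - x ^ (2 * y.2)) * g y =
        ∑ y ∈ Finset.HasAntidiagonal.antidiagonal N, g y := by
      rw [Finset.Nat.sum_antidiagonal_succ']
      simp only [mul_zero, pow_zero, sub_self, zero_mul, zero_add]
      refine Finset.sum_congr rfl fun y _ => ?_
      have a1 := h0 y.1
      have a2 := h0 y.2
      have a3 := h1 y.2
      simp only [hg, qPoch_sq_succ, show 2 * (y.2 + 1) = 2 * y.2 + 2 by ring]
      field_simp
    have e2 : ∑ y ∈ Finset.HasAntidiagonal.antidiagonal (N + 1),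
        x ^ (2 * y.2) * (1 - x ^ (2 * y.1)) * g y =
        ∑ y ∈ Finset.HasAntidiagonal.antidiagonal N, -(v * x ^ (2 * N + 1)) * g y := by
      rw [Finset.Nat.sum_antidiagonal_succ]
      simp only [mul_zero, pow_zero, sub_self, zero_mul, zero_add]
      refine Finset.sum_congr rfl fun y hy => ?_
      have a1 := h0 y.1
      have a2 := h0 y.2
      have a3 := h1 y.1
      rw [← Finset.HasAntidiagonal.mem_antidiagonal.1 hy]
      simp only [hg, qPoch_sq_succ, show 2 * (y.1 + 1) = 2 * y.1 + 2 by ring]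
      field_simp
      ring
    rw [← Finset.mul_sum] at e2
    have e3 : (1 - x ^ (2 * N + 2)) *
        ∑ y ∈ Finset.HasAntidiagonal.antidiagonal (N + 1), g y =
        (1 - v * x ^ (2 * N + 1)) * ∑ y ∈ Finset.HasAntidiagonal.antidiagonal N, g y := by
      rw [sub_eq_add_neg 1 (v * x ^ (2 * N + 1)), add_mul, one_mul, ← e2, ← e1,
        Finset.mul_sum, ← Finset.sum_add_distrib]
      refine Finset.sum_congr rfl fun y hy => ?_
      rw [show 2 * N + 2 = 2 * (N + 1) by ring, ← Finset.HasAntidiagonal.mem_antidiagonal.1 hy]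
      ring
    apply mul_left_cancel₀ (h1 N)
    have a1 := h0 N
    have a2 := h1 N
    rw [e3, ih, qPoch_sq_succ, qPoch_succ]
    field_simp
    ring

theorem sum_range_two_mul_add_one (g : ℕ → ℂ) (n : ℕ) :
    ∑ k ∈ Finset.range (2 * n + 1), g k =
      g n + ∑ s ∈ Finset.range n, (g (n + (s + 1)) + g (n - 1 - s)) := by
  rw [two_mul, add_assoc, Finset.sum_range_add, Finset.sum_range_succ', Finset.sum_add_distrib,
    Finset.sum_range_reflect]
  simp only [add_zero]
  ring

theorem qPoch_succ' (a q : ℂ) (n : ℕ) : qPoch a q (n + 1) = (1 - a) * qPoch (a * q) q n := by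
  rw [qPoch, Finset.prod_range_succ', mul_comm, qPoch, pow_zero, mul_one]
  congr 1
  exact Finset.prod_congr rfl fun k _ => by ring

theorem qPoch_add (a q : ℂ) (m n : ℕ) :
    qPoch a q (m + n) = qPoch a q m * qPoch (a * q ^ m) q n := by
  rw [qPoch, Finset.prod_range_add, qPoch, qPoch]
  congr 1
  exact Finset.prod_congr rfl fun k _ => by ring

/-- Each factor `1 - z x ^ (-(2k-1))` equals `-z x ^ (-(2k-1)) (1 - z⁻¹ x ^ (2k-1))`, and `1 + 3 + ⋯
+ (2n-1) = n²`. -/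
theorem qPoch_reflect {x z : ℂ} (hx : x ≠ 0) (hz : z ≠ 0) (n : ℕ) :
    qPoch (z * (x ^ (2 * n))⁻¹ * x) (x ^ 2) n * x ^ n ^ 2 =
      (-z) ^ n * qPoch (z⁻¹ * x) (x ^ 2) n := by
  induction n with
  | zero => simp
  | succ n ih =>
    have e : z * (x ^ (2 * (n + 1)))⁻¹ * x * x ^ 2 = z * (x ^ (2 * n))⁻¹ * x := by
      field_simp
      ring
    rw [qPoch_succ', e, qPoch_succ, pow_succ (-z), show (n + 1) ^ 2 = n ^ 2 + (2 * n + 1) by ring,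
      pow_add]
    have e2 : (1 - z * (x ^ (2 * (n + 1)))⁻¹ * x) * x ^ (2 * n + 1) =
        -z * (1 - z⁻¹ * x * (x ^ 2) ^ n) := by
      field_simp
      ring
    linear_combination (1 - z * (x ^ (2 * (n + 1)))⁻¹ * x) * x ^ (2 * n + 1) * ih +
      (-z) ^ n * qPoch (z⁻¹ * x) (x ^ 2) n * e2

/-- The sum of the two terms of index `± s` of the series `∑ (-1) ^ s z ^ s x ^ (s²)`. -/
noncomputable def jacobiTerm (z x : ℂ) (s : ℕ) : ℂ :=
  if s = 0 then 1 else (-1) ^ s * x ^ s ^ 2 * (z ^ s + z⁻¹ ^ s)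

theorem sum_jacobiTerm {z x : ℂ} (hx : ‖x‖ < 1) (hx0 : x ≠ 0) (hz : z ≠ 0) (n : ℕ) :
    ∑ s ∈ Finset.range (n + 1), jacobiTerm z x s /
        (qPoch (x ^ 2) (x ^ 2) (n - s) * qPoch (x ^ 2) (x ^ 2) (n + s)) =
      qPoch (z * x) (x ^ 2) n * qPoch (z⁻¹ * x) (x ^ 2) n / qPoch (x ^ 2) (x ^ 2) (2 * n) := by
  -- This shift centres the `2n` factors: the last `n` give `(zx; x²)_n`, the first `n` reflect to
  -- `(z⁻¹x; x²)_n`, and the summation index is recentred at `n`.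
  have h := sum_antidiagonal_euler hx (z * (x ^ (2 * n))⁻¹) (2 * n)
  have e : z * (x ^ (2 * n))⁻¹ * x * (x ^ 2) ^ n = z * x := by
    field_simp
    ring
  rw [Finset.Nat.sum_antidiagonal_eq_sum_range_succ_mk, Nat.succ_eq_add_one,
    sum_range_two_mul_add_one, two_mul n, qPoch_add, ← two_mul, e] at h
  have hz' : (-z) ^ n ≠ 0 := pow_ne_zero _ (neg_ne_zero.2 hz)
  have h' := congrArg (fun y => y * (x ^ n ^ 2 / (-z) ^ n)) h
  simp only at h'
  have hr : qPoch (z * (x ^ (2 * n))⁻¹ * x) (x ^ 2) n * qPoch (z * x) (x ^ 2) n /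
      qPoch (x ^ 2) (x ^ 2) (2 * n) * (x ^ n ^ 2 / (-z) ^ n) =
      qPoch (z * x) (x ^ 2) n * qPoch (z⁻¹ * x) (x ^ 2) n / qPoch (x ^ 2) (x ^ 2) (2 * n) := by
    have := qPoch_reflect hx0 hz n
    have h0 := qPoch_ne_zero (norm_sq_lt_one hx) (norm_sq_lt_one hx) (2 * n)
    rw [div_mul_div_comm, div_eq_div_iff (mul_ne_zero h0 hz') h0]
    linear_combination qPoch (z * x) (x ^ 2) n * qPoch (x ^ 2) (x ^ 2) (2 * n) * this
  have hup : ∀ s, (-(z * (x ^ (2 * n))⁻¹)) ^ (n + s) * x ^ (n + s) ^ 2 * (x ^ n ^ 2 / (-z) ^ n) =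
      (-1) ^ s * x ^ s ^ 2 * z ^ s := by
    intro s
    rw [← neg_mul, mul_pow, pow_add (-z), neg_pow z s, inv_pow, ← pow_mul]
    field_simp
    ring
  have hdown : ∀ m s, m + s = n →
      (-(z * (x ^ (2 * n))⁻¹)) ^ m * x ^ m ^ 2 * (x ^ n ^ 2 / (-z) ^ n) =
      (-1) ^ s * x ^ s ^ 2 * z⁻¹ ^ s := by
    rintro m s rfl
    rw [← neg_mul, mul_pow, pow_add (-z), neg_pow z s, inv_pow, inv_pow, ← pow_mul]
    have : ((-1 : ℂ) ^ s) ^ 2 = 1 := by rw [← pow_mul, mul_comm, pow_mul]; simp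
    have hz'' : -z ≠ 0 := neg_ne_zero.2 hz
    field_simp
    rw [this]
    ring
  rw [← hr, ← h', add_mul, Finset.sum_range_succ', add_comm, Finset.sum_mul]
  congr 1
  · have := hup 0
    simp only [add_zero] at this
    rw [div_mul_eq_mul_div, this]
    simp [jacobiTerm, two_mul]
  · refine Finset.sum_congr rfl fun s hs => ?_
    have hs' := Finset.mem_range.1 hs
    rw [add_mul, div_mul_eq_mul_div, div_mul_eq_mul_div, hup (s + 1),
      hdown (n - 1 - s) (s + 1) (by omega), jacobiTerm, if_neg s.succ_ne_zero,
      show 2 * n - (n + (s + 1)) = n - (s + 1) by omega,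
      show n - 1 - s = n - (s + 1) by omega, show 2 * n - (n - (s + 1)) = n + (s + 1) by omega,
      mul_comm (qPoch (x ^ 2) (x ^ 2) (n + (s + 1)))]
    ring

theorem norm_jacobiTerm_le {z x : ℂ} (hx : ‖x‖ < 1) (s : ℕ) :
    ‖jacobiTerm z x s‖ ≤ ‖z * x‖ ^ s + ‖z⁻¹ * x‖ ^ s := by
  rw [jacobiTerm]
  split_ifs with h
  · simp [h]
  · obtain ⟨k, hk⟩ : ∃ k, s ^ 2 = k + s := ⟨s ^ 2 - s, by
      have : s ≤ s ^ 2 := by nlinarith [Nat.pos_of_ne_zero h]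
      omega⟩
    have h1 : ‖x ^ k‖ ≤ 1 := by simpa using norm_pow_le_of_le hx (Nat.zero_le k)
    calc ‖(-1) ^ s * x ^ s ^ 2 * (z ^ s + z⁻¹ ^ s)‖
        = ‖x ^ k‖ * ‖(z * x) ^ s + (z⁻¹ * x) ^ s‖ := by
          rw [hk, ← norm_mul, mul_assoc, norm_mul, norm_pow, norm_neg, norm_one, one_pow, one_mul]
          congr 1
          ring
      _ ≤ 1 * (‖(z * x) ^ s‖ + ‖(z⁻¹ * x) ^ s‖) := by
          gcongr
          exact norm_add_le _ _
      _ = _ := by rw [one_mul, norm_pow, norm_pow]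

/-- Jacobi's triple product identity in the annulus `‖x‖ < ‖z‖ < ‖x‖⁻¹`. -/
theorem tsum_jacobiTerm {z x : ℂ} (hx : ‖x‖ < 1) (hx0 : x ≠ 0) (hz : z ≠ 0)
    (h1 : ‖z * x‖ < 1) (h2 : ‖z⁻¹ * x‖ < 1) :
    ∑' s, jacobiTerm z x s =
      qPochInf (z * x) (x ^ 2) * qPochInf (z⁻¹ * x) (x ^ 2) * qPochInf (x ^ 2) (x ^ 2) := by
  have hp := norm_sq_lt_one hx
  obtain ⟨D, hD, h'⟩ := exists_norm_inv_qPoch_le hp hp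
  have hne := qPochInf_ne_zero hp hp
  have hT := tendsto_qPoch (x ^ 2) hp
  set P := qPochInf (x ^ 2) (x ^ 2) with hP
  have hbound : Summable fun s : ℕ => (‖z * x‖ ^ s + ‖z⁻¹ * x‖ ^ s) * (D * D) :=
    ((summable_geometric_of_lt_one (norm_nonneg _) h1).add
      (summable_geometric_of_lt_one (norm_nonneg _) h2)).mul_right (D * D)
  have hl : Tendsto (fun n => ∑' s, if s ∈ Finset.range (n + 1) then jacobiTerm z x s /
      (qPoch (x ^ 2) (x ^ 2) (n - s) * qPoch (x ^ 2) (x ^ 2) (n + s)) else 0) atTop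
      (𝓝 (∑' s, jacobiTerm z x s / (P * P))) := by
    refine tendsto_tsum_of_dominated_convergence hbound (fun s => ?_)
      (Eventually.of_forall fun n s => ?_)
    · have t1 : Tendsto (fun n => qPoch (x ^ 2) (x ^ 2) (n - s)) atTop (𝓝 P) :=
        hT.comp (tendsto_sub_atTop_nat s)
      have t2 : Tendsto (fun n => qPoch (x ^ 2) (x ^ 2) (n + s)) atTop (𝓝 P) :=
        hT.comp (tendsto_add_atTop_nat s)
      refine ((tendsto_const_nhds (x := jacobiTerm z x s)).div (t1.mul t2)
        (mul_ne_zero hne hne)).congr' ?_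
      filter_upwards [eventually_ge_atTop s] with n hn
      rw [if_pos (Finset.mem_range.2 (by omega))]
      rfl
    · split_ifs
      · rw [div_eq_mul_inv, mul_inv, norm_mul, norm_mul]
        gcongr
        · exact norm_jacobiTerm_le hx s
        · exact h' _
        · exact h' _
      · rw [norm_zero]
        positivity
  have hr : Tendsto (fun n => qPoch (z * x) (x ^ 2) n * qPoch (z⁻¹ * x) (x ^ 2) n /
      qPoch (x ^ 2) (x ^ 2) (2 * n)) atTop
      (𝓝 (qPochInf (z * x) (x ^ 2) * qPochInf (z⁻¹ * x) (x ^ 2) / P)) :=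
    ((tendsto_qPoch _ hp).mul (tendsto_qPoch _ hp)).div
      (hT.comp (tendsto_id.const_mul_atTop' two_pos)) hne
  have hsum : ∀ n, (∑' s, if s ∈ Finset.range (n + 1) then jacobiTerm z x s /
      (qPoch (x ^ 2) (x ^ 2) (n - s) * qPoch (x ^ 2) (x ^ 2) (n + s)) else 0) =
      qPoch (z * x) (x ^ 2) n * qPoch (z⁻¹ * x) (x ^ 2) n / qPoch (x ^ 2) (x ^ 2) (2 * n) := by
    intro n
    rw [← sum_jacobiTerm hx hx0 hz, tsum_eq_sum (s := Finset.range (n + 1))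
      fun s hs => if_neg hs]
    exact Finset.sum_congr rfl fun s hs => if_pos hs
  simp only [hsum] at hl
  have h := tendsto_nhds_unique hl hr
  rw [tsum_div_const, div_eq_div_iff (mul_ne_zero hne hne) hne] at h
  apply mul_right_cancel₀ hne
  rw [h]
  ring

/-! ### The two theta series. -/

theorem qPochInf_zero_right (q : ℂ) : qPochInf 0 q = 1 := by simp [qPochInf]

theorem tsum_alphaZero {q : ℂ} (hq : ‖q‖ < 1) :
    ∑' r, alphaZero q r * q ^ r ^ 2 =
      qPochInf (q ^ 3) (q ^ 6) * qPochInf (q ^ 3) (q ^ 6) * qPochInf (q ^ 6) (q ^ 6) := by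
  -- The triple product needs `x ≠ 0`, so `q = 0` is checked directly.
  rcases eq_or_ne q 0 with rfl | h0
  · rw [tsum_eq_single 0 fun r hr => by simp [hr]]
    simp [alphaZero, qPochInf_zero_right]
  · have hx : ‖q ^ 3‖ < 1 := by rw [norm_pow]; exact pow_lt_one₀ (norm_nonneg q) hq three_ne_zero
    have h := tsum_jacobiTerm (z := 1) hx (pow_ne_zero 3 h0) one_ne_zero (by simpa using hx)
      (by simpa using hx)
    rw [inv_one, one_mul, ← pow_mul] at h
    rw [← h]
    refine tsum_congr fun r => ?_
    rw [alphaZero, jacobiTerm]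
    split_ifs with hr
    · simp [hr]
    · rw [one_pow, inv_one, one_pow]
      ring

/-- Both sides are `∑ (-1) ^ s q ^ (3s² + 2s)` over all integers `s`. The left groups `s = r` with
`s = -(r+1)`, while `jacobiTerm` groups `s` with `-s`. -/
theorem tsum_alphaOne {q : ℂ} (hq : ‖q‖ < 1) :
    ∑' r : ℕ, (-1) ^ r * q ^ (3 * r ^ 2 + 2 * r) * (1 - q ^ (2 * r + 1)) =
      qPochInf q (q ^ 6) * qPochInf (q ^ 5) (q ^ 6) * qPochInf (q ^ 6) (q ^ 6) := by
  rcases eq_or_ne q 0 with rfl | h0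
  · rw [tsum_eq_single 0 fun r hr => by simp [hr]]
    simp [qPochInf_zero_right]
  · have hx : ‖q ^ 3‖ < 1 := by rw [norm_pow]; exact pow_lt_one₀ (norm_nonneg q) hq three_ne_zero
    have e1 : q ^ 2 * q ^ 3 = q ^ 5 := by ring
    have e2 : (q ^ 2)⁻¹ * q ^ 3 = q := by field_simp
    have hx5 : ‖q ^ 2 * q ^ 3‖ < 1 := by
      rw [e1, norm_pow]; exact pow_lt_one₀ (norm_nonneg q) hq (by norm_num)
    have hx1 : ‖(q ^ 2)⁻¹ * q ^ 3‖ < 1 := by rwa [e2]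
    have h := tsum_jacobiTerm hx (pow_ne_zero 3 h0) (pow_ne_zero 2 h0) hx5 hx1
    rw [e1, e2, ← pow_mul, mul_comm (qPochInf (q ^ 5) _)] at h
    rw [← h]
    have hgeom := summable_geometric_of_lt_one (norm_nonneg q) hq
    have hA : Summable fun r : ℕ => (-1) ^ r * q ^ (3 * r ^ 2 + 2 * r) :=
      Summable.of_norm_bounded hgeom fun r => by
        simpa using norm_pow_le_of_le hq (show r ≤ 3 * r ^ 2 + 2 * r by nlinarith)
    have hB : Summable fun r : ℕ => (-1) ^ (r + 1) * q ^ (3 * r ^ 2 + 4 * r + 1) :=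
      Summable.of_norm_bounded hgeom fun r => by
        simpa using norm_pow_le_of_le hq (show r ≤ 3 * r ^ 2 + 4 * r + 1 by nlinarith)
    have hJ : Summable (jacobiTerm (q ^ 2) (q ^ 3)) :=
      Summable.of_norm_bounded ((summable_geometric_of_lt_one (norm_nonneg _) hx5).add
        (summable_geometric_of_lt_one (norm_nonneg _) hx1)) (norm_jacobiTerm_le hx)
    have hA' := (summable_nat_add_iff 1).2 hA
    rw [hJ.tsum_eq_zero_add]
    have hs : ∀ r : ℕ, jacobiTerm (q ^ 2) (q ^ 3) (r + 1) =
        (-1) ^ (r + 1) * q ^ (3 * (r + 1) ^ 2 + 2 * (r + 1)) +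
          (-1) ^ (r + 1) * q ^ (3 * r ^ 2 + 4 * r + 1) := by
      intro r
      rw [jacobiTerm, if_neg r.succ_ne_zero]
      have : (q ^ 3) ^ (r + 1) ^ 2 * (q ^ 2)⁻¹ ^ (r + 1) = q ^ (3 * r ^ 2 + 4 * r + 1) := by
        rw [inv_pow, mul_inv_eq_iff_eq_mul₀ (pow_ne_zero _ (pow_ne_zero _ h0))]
        ring
      rw [mul_add, mul_assoc _ _ ((q ^ 2)⁻¹ ^ (r + 1)), this]
      ring
    rw [tsum_congr hs, hA'.tsum_add hB, ← add_assoc]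
    have h3 := hA.tsum_eq_zero_add
    have h4 : jacobiTerm (q ^ 2) (q ^ 3) 0 = (-1) ^ 0 * q ^ (3 * 0 ^ 2 + 2 * 0) := by
      simp [jacobiTerm]
    rw [h4, ← h3, ← hA.tsum_add hB]
    refine tsum_congr fun r => ?_
    ring

theorem norm_alphaZero_le {q : ℂ} (hq : ‖q‖ < 1) (r : ℕ) : ‖alphaZero q r‖ ≤ 2 := by
  rw [alphaZero]
  split_ifs
  · simp
  · have := norm_pow_le_of_le hq (Nat.zero_le (2 * r ^ 2))
    rw [norm_mul, norm_mul, norm_pow (-1)]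
    simp only [norm_neg, norm_one, one_pow, mul_one, Complex.norm_ofNat]
    linarith [pow_zero ‖q‖]

theorem norm_alphaOne_le {q : ℂ} (hq : ‖q‖ < 1) (r : ℕ) : ‖alphaOne q r‖ ≤ 2 := by
  have h1 := norm_pow_le_of_le hq (Nat.zero_le (2 * r ^ 2))
  have h2 := norm_pow_le_of_le hq (Nat.zero_le (4 * r + 2))
  have h3 := norm_sub_le 1 (q ^ (4 * r + 2))
  rw [pow_zero] at h1 h2
  rw [norm_one] at h3
  rw [alphaOne, norm_mul, norm_mul, norm_pow (-1), norm_neg, norm_one, one_pow, one_mul]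
  nlinarith [norm_nonneg (q ^ (2 * r ^ 2)), norm_nonneg (1 - q ^ (4 * r + 2))]

/-! ### Product evaluations and conclusion. -/

theorem tailSeries_eq_bailey {q : ℂ} (hq : ‖q‖ < 1) {δ : ℕ} {α : ℕ → ℂ} {M : ℝ}
    (hα : ∀ r, ‖α r‖ ≤ M)
    (hpair : ∀ n, ∑ x ∈ Finset.HasAntidiagonal.antidiagonal n, baileyTerm q δ α x.1 x.2 =
      1 / (qPoch (q ^ 2) (q ^ 2) n * qPoch (-q ^ 2) (q ^ 2) n)) :
    tailSeries q δ 0 = tailProd q 0 *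
      ∑' r, α r * q ^ (r ^ 2 + 2 * δ * r) * ∑' m, gaussTerm q r (r + δ) m := by
  rw [← tsum_bailey hq δ hα, tailSeries, ← tsum_mul_left]
  refine tsum_congr fun n => ?_
  have e := qPoch_ne_zero (norm_neg_sq_lt_one hq) (norm_sq_lt_one hq) n
  have e' := qPoch_ne_zero (norm_sq_lt_one hq) (norm_sq_lt_one hq) n
  rw [hpair, tailCoeff, tailProd_zero_eq hq n, add_zero, pow_add]
  field_simp

theorem qPoch_neg_ne_zero {q : ℂ} (hq : ‖q‖ < 1) (n : ℕ) : qPoch (-q) (q ^ 2) n ≠ 0 :=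
  qPoch_ne_zero (by rwa [norm_neg]) (norm_sq_lt_one hq) n

/-- A Rogers–Ramanujan type identity of modulus six. -/
theorem tailSeries_zero {q : ℂ} (hq : ‖q‖ < 1) :
    tailSeries q 0 0 = tailProd q 0 * (qPochInf (-q) (q ^ 2) / qPochInf (q ^ 2) (q ^ 2)) *
      (qPochInf (q ^ 3) (q ^ 6) * qPochInf (q ^ 3) (q ^ 6) * qPochInf (q ^ 6) (q ^ 6)) := by
  rw [tailSeries_eq_bailey hq (norm_alphaZero_le hq) (bailey_pair_zero hq),
    ← tsum_alphaZero hq, mul_assoc]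
  congr 1
  rw [← tsum_mul_left]
  refine tsum_congr fun r => ?_
  rw [add_zero, mul_left_cancel₀ (qPoch_neg_ne_zero hq r) (qPoch_mul_tsum_gaussTerm hq r r)]
  ring

/-- A Rogers–Ramanujan type identity of modulus six. -/
theorem tailSeries_one {q : ℂ} (hq : ‖q‖ < 1) :
    tailSeries q 1 0 = tailProd q 0 * (qPochInf (-q) (q ^ 2) / qPochInf (q ^ 2) (q ^ 2)) *
      (qPochInf q (q ^ 6) * qPochInf (q ^ 5) (q ^ 6) * qPochInf (q ^ 6) (q ^ 6)) := by
  rw [tailSeries_eq_bailey hq (norm_alphaOne_le hq) (bailey_pair_one hq),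
    ← tsum_alphaOne hq, mul_assoc]
  congr 1
  rw [← tsum_mul_left]
  refine tsum_congr fun r => ?_
  have h := qPoch_mul_tsum_gaussTerm hq r (r + 1)
  -- Since `d = r + 1`, a factor `1 + q ^ (2r+1)` remains after cancellation; it is absorbed by `1 -
  -- q ^ (4r+2)` in `alphaOne`, leaving `1 - q ^ (2r+1)`.
  rw [qPoch_succ, mul_assoc] at h
  rw [← mul_left_cancel₀ (qPoch_neg_ne_zero hq r) h, alphaOne]
  ring

theorem mainTheorem10 (q : ℂ) (hq : ‖q‖ < 1) :
    ContFractConvergesTo (infContFract (1 + q) (modSixNum q) (modSixDen q))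
      (qPochInf (q ^ 3) (q ^ 6) * qPochInf (q ^ 3) (q ^ 6) /
        (qPochInf q (q ^ 6) * qPochInf (q ^ 5) (q ^ 6))) := by
  have hn : ∀ k : ℕ, ‖q ^ (k + 1)‖ < 1 := fun k => by
    rw [norm_pow]; exact pow_lt_one₀ (norm_nonneg q) hq k.succ_ne_zero
  have hK : tailProd q 0 * (qPochInf (-q) (q ^ 2) / qPochInf (q ^ 2) (q ^ 2)) ≠ 0 :=
    mul_ne_zero (tailProd_zero_ne_zero hq) (div_ne_zero
      (qPochInf_ne_zero (by rwa [norm_neg]) (hn 1)) (qPochInf_ne_zero (hn 1) (hn 1)))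
  have h6 : qPochInf (q ^ 6) (q ^ 6) ≠ 0 := qPochInf_ne_zero (hn 5) (hn 5)
  have hne : tailSeries q 1 0 ≠ 0 := by
    rw [tailSeries_one hq]
    exact mul_ne_zero hK (mul_ne_zero (mul_ne_zero (qPochInf_ne_zero hq (hn 5))
      (qPochInf_ne_zero (hn 4) (hn 5))) h6)
  have h := contFractConvergesTo_tailSeries hq hne
  rwa [tailSeries_zero hq, tailSeries_one hq, mul_div_mul_left _ _ hK,
    mul_div_mul_right _ _ h6] at h
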